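/- A Lie groupoid $\Gamma\rightrightarrows\Gamma_0$ (target map $\alpha$, source map $\beta$, product $m$) consists of a smooth, possibly non-Hausdorff, manifold $\Gamma$, a smooth Hausdorff manifold $\Gamma_0$ embedded in $\Gamma$ as the set of units, surjective submersions $\alpha,\beta:\Gamma\to\Gamma_0$, a smooth product $m$ defined on $\Gamma_2=\{(x,y):\beta(x)=\alpha(y)\}$, and a smooth inverse map; manifolds are finite-dimensional, without boundary. It is a symplectic groupoid (resp. a Poisson groupoid) if $\Gamma$ carries a symplectic form $\omega$ (resp. a Poisson structure, i.e. a smooth bivector field $\Pi$ with vanishing Schouten bracket $[\Pi,\Pi]=0$) such that the graph $\{(x,y,m(x,y)) : (x,y)\in\Gamma_2\}$ is a Lagrangian submanifold of $\Gamma\times\Gamma\times\Gamma$ with the symplectic form $\omega\oplus\omega\oplus(-\omega)$ (resp. a coisotropic submanifold for the Poisson structure $\Pi\oplus\Pi\oplus(-\Pi)$, i.e. the bracket of two smooth functions, defined on an open subset, which vanish on the graph, vanishes on the graph). A symplectic manifold $(\Gamma,\omega)$ is equipped with the Poisson structure $\Pi$ for which $\Pi^\sharp:T^*\Gamma\to T\Gamma$,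 $\langle\eta,\Pi^\sharp\zeta\rangle=\Pi(\zeta,\eta)$, is the inverse of $v\mapsto -i(v)\omega$. Let $\Gamma\rightrightarrows\Gamma_0$ be a symplectic groupoid with symplectic form $\omega$, and let $\Pi$ be the Poisson structure on $\Gamma$ associated with $\omega$ (resp. a Poisson groupoid with Poisson structure $\Pi$). Then there exists a unique Poisson structure $\Pi_0$ on $\Gamma_0$ for which $\alpha:(\Gamma,\Pi)\to(\Gamma_0,\Pi_0)$ is a Poisson map, that is, $\{f\circ\alpha,g\circ\alpha\}_{\Pi}=\{f,g\}_{\Pi_0}\circ\alpha$ for all smooth functions $f,g$ on $\Gamma_0$. For this $\Pi_0$, the map $\beta:\Gamma\to\Gamma_0$ is anti-Poisson, that is, $\beta$ is a Poisson map from $(\Gamma,\Pi)$ to $(\Gamma_0,-\Pi_0)$. -/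

import Mathlib

open Set Filter Topology
open scoped Manifold ContDiff

noncomputable section

/-! ### Bivector fields, Poisson structures, Poisson maps -/

section Poisson

variable {E : Type*} [NormedAddCommGroup E] [NormedSpace ℝ E]
  {H : Type*} [TopologicalSpace H] (I : ModelWithCorners ℝ E H)
  {M : Type*} [TopologicalSpace M] [ChartedSpace H M]
  {E' : Type*} [NormedAddCommGroup E'] [NormedSpace ℝ E']
  {H' : Type*} [TopologicalSpace H'] (J : ModelWithCorners ℝ E' H')
  {N : Type*} [TopologicalSpace N] [ChartedSpace H' N]

/-- The cotangent space `T*ₓM`. -/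
abbrev CotangentSpace (x : M) := TangentSpace I x →L[ℝ] ℝ

variable (M) in
/-- A (not necessarily smooth or skew-symmetric) contravariant 2-tensor field on `M`: a bilinear
form on `T*ₓM` for every point `x`. -/
abbrev CotensorField₂ := ∀ x : M, CotangentSpace I x →ₗ[ℝ] CotangentSpace I x →ₗ[ℝ] ℝ

variable {I J}

/-- The bracket `{f, g}(x) = Π(df(x), dg(x))`. It is also used for functions which are smooth only
on an open subset of `M`, at the points of that subset. -/
def poissonBracket (P : CotensorField₂ I M) (f g : M → ℝ) (x : M) : ℝ :=
  P x (mvfderiv I f x) (mvfderiv I g x)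

/-- `P` is a smooth section of `⋀² TM`: every `P x` is an alternating bilinear form on `T*ₓM`
(that is, an element of `⋀² TₓM`) and it depends smoothly on `x`, i.e. for all smooth functions
`f, g` on an open set `U`, for example coordinate functions, `P(df, dg)` is smooth on `U`. -/
structure IsBivectorField (P : CotensorField₂ I M) : Prop where
  alt : ∀ x (a : CotangentSpace I x), P x a a = 0
  smooth : ∀ (U : Set M), IsOpen U → ∀ f g : M → ℝ,
    ContMDiffOn I 𝓘(ℝ, ℝ) ∞ f U → ContMDiffOn I 𝓘(ℝ, ℝ) ∞ g U →
      ContMDiffOn I 𝓘(ℝ, ℝ) ∞ (poissonBracket P f g) U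

/-- The Schouten bracket `[P, Q]` of two bivector fields, evaluated at `x` on the differentials
`df(x), dg(x), dh(x)` of functions which are smooth near `x` (up to the overall sign, which depends
on conventions). As the differentials of local functions fill `T*ₓM`, these values determine the
trivector `[P, Q](x)`. -/
def schoutenBracket (P Q : CotensorField₂ I M) (f g h : M → ℝ) (x : M) : ℝ :=
  (poissonBracket P (poissonBracket Q f g) h x + poissonBracket Q (poissonBracket P f g) h x)
  + (poissonBracket P (poissonBracket Q g h) f x + poissonBracket Q (poissonBracket P g h) f x)
  + (poissonBracket P (poissonBracket Q h f) g x + poissonBracket Q (poissonBracket P h f) g x)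

/-- A Poisson structure: a smooth bivector field `P` with `[P, P] = 0`. -/
structure IsPoissonStructure (P : CotensorField₂ I M) : Prop extends IsBivectorField P where
  schouten : ∀ (U : Set M), IsOpen U → ∀ f g h : M → ℝ,
    ContMDiffOn I 𝓘(ℝ, ℝ) ∞ f U → ContMDiffOn I 𝓘(ℝ, ℝ) ∞ g U → ContMDiffOn I 𝓘(ℝ, ℝ) ∞ h U →
      ∀ x ∈ U, schoutenBracket P P f g h x = 0

/-- `φ : (M, P) → (N, Q)` is a Poisson map. -/
structure IsPoissonMap (φ : M → N) (P : CotensorField₂ I M) (Q : CotensorField₂ J N) :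
    Prop where
  smooth : ContMDiff I J ∞ φ
  map_bracket : ∀ f g : N → ℝ, ContMDiff J 𝓘(ℝ, ℝ) ∞ f → ContMDiff J 𝓘(ℝ, ℝ) ∞ g →
    ∀ x, poissonBracket P (f ∘ φ) (g ∘ φ) x = poissonBracket Q f g (φ x)

variable (I J) in
/-- The inclusion `TₓM → T₍ₓ,ᵧ₎(M × N) = TₓM × TᵧN`. -/
def tangentInl (p : M × N) : TangentSpace I p.1 →L[ℝ] TangentSpace (I.prod J) p :=
  ContinuousLinearMap.inl ℝ E E'

variable (I J) in
/-- The inclusion `TᵧN → T₍ₓ,ᵧ₎(M × N) = TₓM × TᵧN`. -/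
def tangentInr (p : M × N) : TangentSpace J p.2 →L[ℝ] TangentSpace (I.prod J) p :=
  ContinuousLinearMap.inr ℝ E E'

/-- Restriction of a covector on `M × N` to the tangent space of the first factor. -/
def covectorFst (p : M × N) : CotangentSpace (I.prod J) p →ₗ[ℝ] CotangentSpace I p.1 where
  toFun a := a.comp (tangentInl I J p)
  map_add' _ _ := rfl
  map_smul' _ _ := rfl

/-- Restriction of a covector on `M × N` to the tangent space of the second factor. -/
def covectorSnd (p : M × N) : CotangentSpace (I.prod J) p →ₗ[ℝ] CotangentSpace J p.2 where
  toFun a := a.comp (tangentInr I J p)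
  map_add' _ _ := rfl
  map_smul' _ _ := rfl

/-- The product structure `P ⊕ Q` on `M × N`. -/
def CotensorField₂.prod (P : CotensorField₂ I M) (Q : CotensorField₂ J N) :
    CotensorField₂ (I.prod J) (M × N) := fun p =>
  (P p.1).compl₁₂ (covectorFst p) (covectorFst p)
    + (Q p.2).compl₁₂ (covectorSnd p) (covectorSnd p)

/-- `S` is coisotropic in `(M, P)`: the bracket of two smooth functions, defined on an open
subset of `M`, which vanish on `S`, vanishes on `S`. -/
def IsCoisotropic (P : CotensorField₂ I M) (S : Set M) : Prop :=
  ∀ (U : Set M), IsOpen U → ∀ f g : M → ℝ,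
    ContMDiffOn I 𝓘(ℝ, ℝ) ∞ f U → ContMDiffOn I 𝓘(ℝ, ℝ) ∞ g U →
    (∀ x ∈ S ∩ U, f x = 0) → (∀ x ∈ S ∩ U, g x = 0) →
      ∀ x ∈ S ∩ U, poissonBracket P f g x = 0

end Poisson

/-! ### Symplectic forms -/

section Symplectic

variable {E : Type*} [NormedAddCommGroup E] [NormedSpace ℝ E]
  {H : Type*} [TopologicalSpace H] (I : ModelWithCorners ℝ E H)
  {M : Type*} [TopologicalSpace M] [ChartedSpace H M]
  {E' : Type*} [NormedAddCommGroup E'] [NormedSpace ℝ E']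
  {H' : Type*} [TopologicalSpace H'] (J : ModelWithCorners ℝ E' H')
  {N : Type*} [TopologicalSpace N] [ChartedSpace H' N]

variable (M) in
/-- A (not necessarily smooth) differential 2-form on `M`. -/
abbrev TwoForm := ∀ x : M, TangentSpace I x [⋀^Fin 2]→L[ℝ] ℝ

variable {I J}

/-- The expression of a 2-form in the preferred chart at `x₀`: its pullback by the inverse of that
chart, a 2-form on an open subset of `E`. -/
def TwoForm.inChart (σ : TwoForm I M) (x₀ : M) (y : E) : E [⋀^Fin 2]→L[ℝ] ℝ :=
  (σ ((extChartAt I x₀).symm y)).compContinuousLinearMap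
    (mfderiv 𝓘(ℝ, E) I (extChartAt I x₀).symm y)

/-- A symplectic form on a manifold without boundary: a smooth 2-form which is closed and
nondegenerate. -/
structure IsSymplecticForm [I.Boundaryless] (σ : TwoForm I M) : Prop where
  smooth : ∀ x₀ : M, ContDiffOn ℝ ∞ (σ.inChart x₀) (extChartAt I x₀).target
  closed : ∀ x₀ : M, ∀ y ∈ (extChartAt I x₀).target, extDeriv (σ.inChart x₀) y = 0
  nondegenerate : ∀ (x : M) (v : TangentSpace I x), v ≠ 0 → ∃ w, σ x ![v, w] ≠ 0

theorem update_pair_zero {V : Type*} (a b c : V) : Function.update ![a, b] 0 c = ![c, b] := by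
  ext i; fin_cases i <;> rfl

theorem update_pair_one {V : Type*} (a b c : V) : Function.update ![a, b] 1 c = ![a, c] := by
  ext i; fin_cases i <;> rfl

theorem TwoForm.map_add_right (σ : TwoForm I M) (x : M) (v w w' : TangentSpace I x) :
    σ x ![v, w + w'] = σ x ![v, w] + σ x ![v, w'] := by
  have := (σ x).map_update_add ![v, 0] 1 w w'
  simpa only [update_pair_zero, update_pair_one, smul_eq_mul] using this

theorem TwoForm.map_smul_right (σ : TwoForm I M) (x : M) (v w : TangentSpace I x) (c : ℝ) :
    σ x ![v, c • w] = c * σ x ![v, w] := by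
  have := (σ x).map_update_smul ![v, 0] 1 c w
  simpa only [update_pair_zero, update_pair_one, smul_eq_mul] using this

theorem TwoForm.map_add_left (σ : TwoForm I M) (x : M) (v v' w : TangentSpace I x) :
    σ x ![v + v', w] = σ x ![v, w] + σ x ![v', w] := by
  have := (σ x).map_update_add ![0, w] 0 v v'
  simpa only [update_pair_zero, update_pair_one, smul_eq_mul] using this

theorem TwoForm.map_smul_left (σ : TwoForm I M) (x : M) (v w : TangentSpace I x) (c : ℝ) :
    σ x ![c • v, w] = c * σ x ![v, w] := by
  have := (σ x).map_update_smul ![0, w] 0 c v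
  simpa only [update_pair_zero, update_pair_one, smul_eq_mul] using this

/-- The linear map `v ↦ -i(v)σ = -σ(v, ·)` from `TₓM` to `T*ₓM`. -/
def TwoForm.flat (σ : TwoForm I M) (x : M) : TangentSpace I x →ₗ[ℝ] CotangentSpace I x where
  toFun v :=
    { toFun := fun w => -σ x ![v, w]
      map_add' := fun w w' => by rw [σ.map_add_right, neg_add]
      map_smul' := fun c w => by simp [σ.map_smul_right]
      cont := ((σ x).cont.comp (continuous_pi (Fin.forall_fin_two.2
        ⟨continuous_const, continuous_id⟩))).neg }
  map_add' v v' := ContinuousLinearMap.ext fun w => by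
    change -σ x ![v + v', w] = -σ x ![v, w] + -σ x ![v', w]
    rw [σ.map_add_left, neg_add]
  map_smul' c v := ContinuousLinearMap.ext fun w => by
    change -σ x ![c • v, w] = c * -σ x ![v, w]
    rw [σ.map_smul_left, mul_neg]

theorem IsSymplecticForm.flat_bijective [FiniteDimensional ℝ E] [I.Boundaryless]
    {σ : TwoForm I M} (hσ : IsSymplecticForm σ) (x : M) : Function.Bijective (σ.flat x) := by
  have hinj : Function.Injective (σ.flat x) := by
    rw [injective_iff_map_eq_zero]
    intro v hv
    by_contra hne
    obtain ⟨w, hw⟩ := hσ.nondegenerate x v hne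
    have : -σ x ![v, w] = 0 := congrArg (fun a : CotangentSpace I x => a w) hv
    exact hw (neg_eq_zero.1 this)
  let e : (E →ₗ[ℝ] ℝ) ≃ₗ[ℝ] (E →L[ℝ] ℝ) := LinearMap.toContinuousLinearMap
  have hdim : Module.finrank ℝ E = Module.finrank ℝ (E →L[ℝ] ℝ) := by
    rw [← e.finrank_eq, Module.finrank_linearMap_self]
  have : FiniteDimensional ℝ (E →L[ℝ] ℝ) := e.finiteDimensional
  exact ⟨hinj, (LinearMap.injective_iff_surjective_of_finrank_eq_finrank (V := E)
    (V₂ := E →L[ℝ] ℝ) hdim (f := σ.flat x)).1 hinj⟩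

/-- The map `Π♯ : T*ₓM → TₓM`, inverse of `v ↦ -i(v)σ`. -/
def IsSymplecticForm.sharp [FiniteDimensional ℝ E] [I.Boundaryless]
    {σ : TwoForm I M} (hσ : IsSymplecticForm σ) (x : M) :
    CotangentSpace I x ≃ₗ[ℝ] TangentSpace I x :=
  (LinearEquiv.ofBijective (σ.flat x) (hσ.flat_bijective x)).symm

/-- The Poisson structure of a symplectic manifold: `Π(ζ, η) = ⟨η, Π♯ ζ⟩`. -/
def IsSymplecticForm.poisson [FiniteDimensional ℝ E] [I.Boundaryless]
    {σ : TwoForm I M} (hσ : IsSymplecticForm σ) : CotensorField₂ I M := fun x =>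
  LinearMap.mk₂ ℝ (fun ζ η => η (hσ.sharp x ζ))
    (fun ζ ζ' η => by rw [map_add, map_add]) (fun c ζ η => by rw [map_smul, map_smul])
    (fun _ _ _ => rfl) (fun _ _ _ => rfl)

variable (I J) in
/-- The projection `T₍ₓ,ᵧ₎(M × N) = TₓM × TᵧN → TₓM`. -/
def tangentFst (p : M × N) : TangentSpace (I.prod J) p →L[ℝ] TangentSpace I p.1 :=
  ContinuousLinearMap.fst ℝ E E'

variable (I J) in
/-- The projection `T₍ₓ,ᵧ₎(M × N) = TₓM × TᵧN → TᵧN`. -/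
def tangentSnd (p : M × N) : TangentSpace (I.prod J) p →L[ℝ] TangentSpace J p.2 :=
  ContinuousLinearMap.snd ℝ E E'

/-- The product 2-form `σ ⊕ τ` on `M × N`. -/
def TwoForm.prod (σ : TwoForm I M) (τ : TwoForm J N) : TwoForm (I.prod J) (M × N) := fun p =>
  (σ p.1).compContinuousLinearMap (tangentFst I J p)
    + (τ p.2).compContinuousLinearMap (tangentSnd I J p)

/-- The set of vectors tangent at `p` to a subset `S` of `M`: the velocities at time `0` of the
smooth curves in `S` passing through `p` at time `0`. If `S` is a submanifold and `p ∈ S`, this is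
the tangent space `T_p S`. -/
def tangentVectors (S : Set M) (p : M) : Set (TangentSpace I p) :=
  {v | ∃ γ : ℝ → M, ContMDiffAt 𝓘(ℝ, ℝ) I ∞ γ 0 ∧ (∀ᶠ t in 𝓝 (0 : ℝ), γ t ∈ S) ∧
    tangentMap 𝓘(ℝ, ℝ) I γ ⟨0, (1 : ℝ)⟩ = ⟨p, v⟩}

/-- The submanifold `S` of `M` is Lagrangian for the symplectic form `σ`: every tangent space
`T_p S` is equal to its symplectic orthogonal. -/
def IsLagrangian (σ : TwoForm I M) (S : Set M) : Prop :=
  ∀ p ∈ S, ∀ v : TangentSpace I p,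
    v ∈ tangentVectors (I := I) S p ↔ ∀ w ∈ tangentVectors (I := I) S p, σ p ![v, w] = 0

end Symplectic

/-! ### Lie groupoids, symplectic groupoids, Poisson groupoids -/

section Groupoid

/-- A Lie groupoid with total space `Γ` (a maybe non-Hausdorff smooth manifold) and unit manifold
`Γ₀` (a Hausdorff smooth manifold, which `unit` embeds in `Γ`). The product is written as a total
function `mul`, of which only the values on composable pairs matter. -/
structure LieGroupoid {E : Type*} [NormedAddCommGroup E] [NormedSpace ℝ E]
    {H : Type*} [TopologicalSpace H] (I : ModelWithCorners ℝ E H)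
    {E₀ : Type*} [NormedAddCommGroup E₀] [NormedSpace ℝ E₀]
    {H₀ : Type*} [TopologicalSpace H₀] (I₀ : ModelWithCorners ℝ E₀ H₀)
    (Γ : Type*) [TopologicalSpace Γ] [ChartedSpace H Γ] [IsManifold I ∞ Γ]
    (Γ₀ : Type*) [TopologicalSpace Γ₀] [ChartedSpace H₀ Γ₀] [IsManifold I₀ ∞ Γ₀] [T2Space Γ₀] where
  /-- the target map `α` -/
  target : Γ → Γ₀
  /-- the source map `β` -/
  source : Γ → Γ₀
  /-- the unit section `ε` -/
  unit : Γ₀ → Γ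
  /-- the product `m` -/
  mul : Γ → Γ → Γ
  /-- the inverse `ι` -/
  inv : Γ → Γ
  target_unit : ∀ u, target (unit u) = u
  source_unit : ∀ u, source (unit u) = u
  target_mul : ∀ x y, source x = target y → target (mul x y) = target x
  source_mul : ∀ x y, source x = target y → source (mul x y) = source y
  mul_assoc : ∀ x y z, source x = target y → source y = target z →
    mul x (mul y z) = mul (mul x y) z
  unit_mul : ∀ x, mul (unit (target x)) x = x
  mul_unit : ∀ x, mul x (unit (source x)) = x
  target_inv : ∀ x, target (inv x) = source x
  source_inv : ∀ x, source (inv x) = target x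
  mul_inv : ∀ x, mul x (inv x) = unit (target x)
  inv_mul : ∀ x, mul (inv x) x = unit (source x)
  /- `α` and `β` are surjective by `target_unit`, `source_unit`; `ι` is an involution, hence a
  diffeomorphism once it is smooth. The set of composable pairs is an embedded submanifold of
  `Γ × Γ`, so that smoothness of `m` on it is smoothness in the sense of `ContMDiffOn`. -/
  target_submersion : Manifold.IsSubmersion I I₀ ∞ target
  source_submersion : Manifold.IsSubmersion I I₀ ∞ source
  unit_embedding : Manifold.IsSmoothEmbedding I₀ I ∞ unit
  smooth_mul : ContMDiffOn (I.prod I) I ∞ (fun p : Γ × Γ => mul p.1 p.2)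
    {p : Γ × Γ | source p.1 = target p.2}
  smooth_inv : ContMDiff I I ∞ inv

variable {E : Type*} [NormedAddCommGroup E] [NormedSpace ℝ E]
  {H : Type*} [TopologicalSpace H] {I : ModelWithCorners ℝ E H}
  {E₀ : Type*} [NormedAddCommGroup E₀] [NormedSpace ℝ E₀]
  {H₀ : Type*} [TopologicalSpace H₀] {I₀ : ModelWithCorners ℝ E₀ H₀}
  {Γ : Type*} [TopologicalSpace Γ] [ChartedSpace H Γ] [IsManifold I ∞ Γ]
  {Γ₀ : Type*} [TopologicalSpace Γ₀] [ChartedSpace H₀ Γ₀] [IsManifold I₀ ∞ Γ₀] [T2Space Γ₀]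

/-- The graph `{(x, y, m(x, y))}` of the product of a Lie groupoid. (It is automatically a
submanifold of `Γ × Γ × Γ`, as the graph of a smooth map on a submanifold of `Γ × Γ`.) -/
def LieGroupoid.graph (G : LieGroupoid I I₀ Γ Γ₀) : Set (Γ × Γ × Γ) :=
  {p | G.source p.1 = G.target p.2.1 ∧ p.2.2 = G.mul p.1 p.2.1}

/-- `(G, σ)` is a symplectic groupoid: `σ` is a symplectic form on `Γ` and the graph of the product
is Lagrangian for `σ ⊕ σ ⊕ (-σ)`. -/
structure LieGroupoid.IsSymplecticGroupoid [I.Boundaryless] (G : LieGroupoid I I₀ Γ Γ₀)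
    (σ : TwoForm I Γ) : Prop where
  symplectic : IsSymplecticForm σ
  lagrangian : IsLagrangian (σ.prod (TwoForm.prod σ (-σ))) G.graph

/-- `(G, P)` is a Poisson groupoid: `P` is a Poisson structure on `Γ` and the graph of the product
is coisotropic for `P ⊕ P ⊕ (-P)`. -/
structure LieGroupoid.IsPoissonGroupoid (G : LieGroupoid I I₀ Γ Γ₀)
    (P : CotensorField₂ I Γ) : Prop where
  poisson : IsPoissonStructure P
  coisotropic : IsCoisotropic (P.prod (CotensorField₂.prod P (-P))) G.graph

end Groupoid

end

/-! The symplectic case reduces to the Poisson case. Closedness of the form gives the Jacobi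
identity (`localBracket_jacobi`, read in a chart), and a Lagrangian graph is coisotropic
(`isCoisotropic_of_isLagrangian`). For a Poisson groupoid, coisotropy is tested on functions `a(x) +
b(y) + c(z)` vanishing on the graph `z = xy`. Their brackets split, so that `{a, a'}(x) + {b, b'}(y)
= {c, c'}(xy)` (`bracket_add_sub_eq_zero`). Write `α`, `β` for target and source. Three choices
suffice. - `f(α x) - f(α z)`, with `y = x⁻¹`: the bracket of two functions pulled back by `α` has
the same value at `x` and at the unit `α x`. It is thus constant on `α`-fibres and descends to a
bracket on the units. - `f(β y) - f(β z)`, with `x = y⁻¹`: the same for `β`. - `f(β x) - f(α y)`, at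
a pair of equal units: on units the two pulled-back brackets are opposite, so `β` is anti-Poisson.
The descended structure `unitBivector` is the push-forward of `P` by `dα` along the units. It is
smooth because its brackets are brackets on `Γ` composed with the unit section, and its Jacobi
identity is the one on `Γ` for functions pulled back by `α`. Uniqueness holds because `α` is
surjective and every covector on the Hausdorff manifold `Γ₀` is the differential of a global
function. On `Γ`, which may fail to be Hausdorff, no bump functions are needed. -/

noncomputable section

/-! ### Brackets on products, and functions with prescribed differential. -/

section PoissonBracket

variable {E : Type*} [NormedAddCommGroup E] [NormedSpace ℝ E]
  {H : Type*} [TopologicalSpace H] {I : ModelWithCorners ℝ E H}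
  {M : Type*} [TopologicalSpace M] [ChartedSpace H M]
  {E' : Type*} [NormedAddCommGroup E'] [NormedSpace ℝ E']
  {H' : Type*} [TopologicalSpace H'] {J : ModelWithCorners ℝ E' H'}
  {N : Type*} [TopologicalSpace N] [ChartedSpace H' N]

theorem mvfderiv_congr {f g : M → ℝ} {x : M} (h : f =ᶠ[𝓝 x] g) :
    mvfderiv I f x = mvfderiv I g x :=
  h.mfderiv_eq

theorem poissonBracket_congr (P : CotensorField₂ I M) {f f' g g' : M → ℝ} {x : M}
    (hf : f =ᶠ[𝓝 x] f') (hg : g =ᶠ[𝓝 x] g') :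
    poissonBracket P f g x = poissonBracket P f' g' x := by
  rw [poissonBracket, poissonBracket, mvfderiv_congr hf, mvfderiv_congr hg]

theorem poissonBracket_neg (P : CotensorField₂ I M) (f g : M → ℝ) (x : M) :
    poissonBracket (-P) f g x = -poissonBracket P f g x := rfl

theorem poissonBracket_const_left (P : CotensorField₂ I M) (c : ℝ) (g : M → ℝ) (x : M) :
    poissonBracket P (fun _ => c) g x = 0 := by
  rw [poissonBracket, mvfderiv_const, map_zero, LinearMap.zero_apply]

theorem poissonBracket_neg_neg (P : CotensorField₂ I M) (f g : M → ℝ) (x : M) :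
    poissonBracket P (fun y => -f y) (fun y => -g y) x = poissonBracket P f g x := by
  simp only [poissonBracket, mvfderiv_fun_neg, map_neg, LinearMap.neg_apply, neg_neg]

theorem covectorFst_mvfderiv_add {f : M → ℝ} {g : N → ℝ} {p : M × N}
    (hf : MDifferentiableAt I 𝓘(ℝ, ℝ) f p.1) (hg : MDifferentiableAt J 𝓘(ℝ, ℝ) g p.2) :
    covectorFst p (mvfderiv (I.prod J) (fun q : M × N => f q.1 + g q.2) p) = mvfderiv I f p.1 := by
  have h1 : MDifferentiableAt (I.prod J) 𝓘(ℝ, ℝ) (f ∘ Prod.fst) p :=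
    hf.comp p mdifferentiableAt_fst
  have h2 : MDifferentiableAt (I.prod J) 𝓘(ℝ, ℝ) (g ∘ Prod.snd) p :=
    hg.comp p mdifferentiableAt_snd
  have := mvfderiv_add h1 h2
  rw [mvfderiv_comp p hf mdifferentiableAt_fst, mvfderiv_comp p hg mdifferentiableAt_snd,
    mfderiv_fst, mfderiv_snd] at this
  change covectorFst p (mvfderiv (I.prod J) (f ∘ Prod.fst + g ∘ Prod.snd) p) = _
  rw [this]
  ext v
  change mvfderiv I f p.1 v + mvfderiv J g p.2 0 = mvfderiv I f p.1 v
  rw [map_zero, add_zero]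

theorem covectorSnd_mvfderiv_add {f : M → ℝ} {g : N → ℝ} {p : M × N}
    (hf : MDifferentiableAt I 𝓘(ℝ, ℝ) f p.1) (hg : MDifferentiableAt J 𝓘(ℝ, ℝ) g p.2) :
    covectorSnd p (mvfderiv (I.prod J) (fun q : M × N => f q.1 + g q.2) p) = mvfderiv J g p.2 := by
  have h1 : MDifferentiableAt (I.prod J) 𝓘(ℝ, ℝ) (f ∘ Prod.fst) p :=
    hf.comp p mdifferentiableAt_fst
  have h2 : MDifferentiableAt (I.prod J) 𝓘(ℝ, ℝ) (g ∘ Prod.snd) p :=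
    hg.comp p mdifferentiableAt_snd
  have := mvfderiv_add h1 h2
  rw [mvfderiv_comp p hf mdifferentiableAt_fst, mvfderiv_comp p hg mdifferentiableAt_snd,
    mfderiv_fst, mfderiv_snd] at this
  change covectorSnd p (mvfderiv (I.prod J) (f ∘ Prod.fst + g ∘ Prod.snd) p) = _
  rw [this]
  ext v
  change mvfderiv I f p.1 0 + mvfderiv J g p.2 v = mvfderiv J g p.2 v
  rw [map_zero, zero_add]

theorem poissonBracket_prod_add (P : CotensorField₂ I M) (Q : CotensorField₂ J N)
    {f f' : M → ℝ} {g g' : N → ℝ} {p : M × N}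
    (hf : MDifferentiableAt I 𝓘(ℝ, ℝ) f p.1) (hf' : MDifferentiableAt I 𝓘(ℝ, ℝ) f' p.1)
    (hg : MDifferentiableAt J 𝓘(ℝ, ℝ) g p.2) (hg' : MDifferentiableAt J 𝓘(ℝ, ℝ) g' p.2) :
    poissonBracket (P.prod Q) (fun q => f q.1 + g q.2) (fun q => f' q.1 + g' q.2) p
      = poissonBracket P f f' p.1 + poissonBracket Q g g' p.2 := by
  simp only [poissonBracket, CotensorField₂.prod, LinearMap.add_apply, LinearMap.compl₁₂_apply]
  rw [covectorFst_mvfderiv_add hf hg, covectorFst_mvfderiv_add hf' hg',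
    covectorSnd_mvfderiv_add hf hg, covectorSnd_mvfderiv_add hf' hg']

/-- On a Hausdorff manifold, every covector is the differential of a global smooth function. -/
theorem exists_contMDiff_mvfderiv_eq [FiniteDimensional ℝ E] [I.Boundaryless] [IsManifold I ∞ M]
    [T2Space M] (x : M) (a : CotangentSpace I x) :
    ∃ f : M → ℝ, ContMDiff I 𝓘(ℝ, ℝ) ∞ f ∧ mvfderiv I f x = a := by
  have hx : x ∈ (chartAt H x).source := mem_chart_source H x
  have hφ : MDifferentiableAt I 𝓘(ℝ, E) (extChartAt I x) x := mdifferentiableAt_extChartAt hx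
  obtain ⟨A, hA⟩ := isInvertible_mfderiv_extChartAt (I := I) (mem_extChartAt_source (I := I) x)
  -- Since `A` is the differential of the chart at `x`, `b` composed with the chart has differential
  -- `b ∘ A = a`. The cutoff `χ` equals 1 near `x` and does not change it.
  let b : E →L[ℝ] ℝ := a.comp (A.symm : TangentSpace 𝓘(ℝ, E) (extChartAt I x x) →L[ℝ]
    TangentSpace I x)
  let χ : SmoothBumpFunction I x := Classical.arbitrary _
  refine ⟨fun y => χ y • (b ∘ extChartAt I x) y, χ.contMDiff_smul ?_, ?_⟩
  · exact b.contDiff.contMDiff.comp_contMDiffOn contMDiffOn_extChartAt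
  · have hev : (fun y => χ y • (b ∘ extChartAt I x) y) =ᶠ[𝓝 x] b ∘ extChartAt I x := by
      filter_upwards [χ.eventuallyEq_one] with y hy
      rw [hy, Pi.one_apply, one_smul]
    have hb : MDifferentiableAt 𝓘(ℝ, E) 𝓘(ℝ, ℝ) b (extChartAt I x x) :=
      b.differentiableAt.mdifferentiableAt
    rw [mvfderiv_congr hev, mvfderiv_comp x hb hφ]
    have : mvfderiv 𝓘(ℝ, E) b (extChartAt I x x) = b := by
      change mfderiv 𝓘(ℝ, E) 𝓘(ℝ, ℝ) b (extChartAt I x x) = b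
      rw [mfderiv_eq_fderiv, b.fderiv]
    rw [this, ← hA]
    ext v
    change a (A.symm (A v)) = a v
    rw [A.symm_apply_apply]

end PoissonBracket

/-! ### Poisson groupoids and the induced structure on the units. -/

section PoissonGroupoid

variable {E : Type*} [NormedAddCommGroup E] [NormedSpace ℝ E]
  {H : Type*} [TopologicalSpace H] {I : ModelWithCorners ℝ E H}
  {E₀ : Type*} [NormedAddCommGroup E₀] [NormedSpace ℝ E₀]
  {H₀ : Type*} [TopologicalSpace H₀] {I₀ : ModelWithCorners ℝ E₀ H₀}
  {Γ : Type*} [TopologicalSpace Γ] [ChartedSpace H Γ] [IsManifold I ∞ Γ]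
  {Γ₀ : Type*} [TopologicalSpace Γ₀] [ChartedSpace H₀ Γ₀] [IsManifold I₀ ∞ Γ₀] [T2Space Γ₀]

namespace LieGroupoid

variable {G : LieGroupoid I I₀ Γ Γ₀} {P : CotensorField₂ I Γ}

theorem contMDiff_target (G : LieGroupoid I I₀ Γ Γ₀) : ContMDiff I I₀ ∞ G.target :=
  G.target_submersion.contMDiff

theorem contMDiff_source (G : LieGroupoid I I₀ Γ Γ₀) : ContMDiff I I₀ ∞ G.source :=
  G.source_submersion.contMDiff

theorem contMDiff_unit (G : LieGroupoid I I₀ Γ Γ₀) : ContMDiff I₀ I ∞ G.unit :=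
  G.unit_embedding.contMDiff

/-- Coisotropy of the graph applied to functions with separated variables; the minus sign comes from
the third factor `-P`. Smoothness is local but vanishing is asked on all composable pairs: for
pullbacks of a function on `Γ₀` smooth only on an open set, the identities needed are algebraic and
hold everywhere. -/
theorem IsPoissonGroupoid.bracket_add_sub_eq_zero (hP : G.IsPoissonGroupoid P)
    {A B C : Set Γ} (hA : IsOpen A) (hB : IsOpen B) (hC : IsOpen C) {a a' b b' c c' : Γ → ℝ}
    (ha : ContMDiffOn I 𝓘(ℝ, ℝ) ∞ a A) (ha' : ContMDiffOn I 𝓘(ℝ, ℝ) ∞ a' A)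
    (hb : ContMDiffOn I 𝓘(ℝ, ℝ) ∞ b B) (hb' : ContMDiffOn I 𝓘(ℝ, ℝ) ∞ b' B)
    (hc : ContMDiffOn I 𝓘(ℝ, ℝ) ∞ c C) (hc' : ContMDiffOn I 𝓘(ℝ, ℝ) ∞ c' C)
    (h : ∀ x y, G.source x = G.target y → a x + (b y + c (G.mul x y)) = 0)
    (h' : ∀ x y, G.source x = G.target y → a' x + (b' y + c' (G.mul x y)) = 0)
    {x y : Γ} (hxy : G.source x = G.target y) (hx : x ∈ A) (hy : y ∈ B) (hz : G.mul x y ∈ C) :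
    poissonBracket P a a' x + poissonBracket P b b' y - poissonBracket P c c' (G.mul x y) = 0 := by
  have hsmooth : ∀ {a b c : Γ → ℝ}, ContMDiffOn I 𝓘(ℝ, ℝ) ∞ a A → ContMDiffOn I 𝓘(ℝ, ℝ) ∞ b B →
      ContMDiffOn I 𝓘(ℝ, ℝ) ∞ c C → ContMDiffOn (I.prod (I.prod I)) 𝓘(ℝ, ℝ) ∞
        (fun p : Γ × Γ × Γ => a p.1 + (b p.2.1 + c p.2.2)) (A ×ˢ (B ×ˢ C)) := by
    intro a b c ha hb hc
    refine (ha.comp contMDiffOn_fst fun p hp => hp.1).add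
      ((hb.comp (contMDiff_fst.comp contMDiff_snd).contMDiffOn fun p hp => hp.2.1).add
      (hc.comp (contMDiff_snd.comp contMDiff_snd).contMDiffOn fun p hp => hp.2.2))
  have hvanish : ∀ {a b c : Γ → ℝ},
      (∀ x y, G.source x = G.target y → a x + (b y + c (G.mul x y)) = 0) →
      ∀ p ∈ G.graph ∩ A ×ˢ (B ×ˢ C), a p.1 + (b p.2.1 + c p.2.2) = 0 := by
    rintro a b c h ⟨x, y, z⟩ ⟨⟨hxy, rfl : z = G.mul x y⟩, -⟩
    exact h x y hxy
  have key := hP.coisotropic (A ×ˢ (B ×ˢ C)) (hA.prod (hB.prod hC)) _ _ (hsmooth ha hb hc)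
    (hsmooth ha' hb' hc') (hvanish h) (hvanish h') (x, y, G.mul x y) ⟨⟨hxy, rfl⟩, hx, hy, hz⟩
  have hd : ∀ {f : Γ → ℝ} {U : Set Γ} {u : Γ}, ContMDiffOn I 𝓘(ℝ, ℝ) ∞ f U → IsOpen U → u ∈ U →
      MDifferentiableAt I 𝓘(ℝ, ℝ) f u := fun hf hU hu =>
    (hf.contMDiffAt (hU.mem_nhds hu)).mdifferentiableAt (by simp)
  have hbc : ∀ {b c : Γ → ℝ}, ContMDiffOn I 𝓘(ℝ, ℝ) ∞ b B → ContMDiffOn I 𝓘(ℝ, ℝ) ∞ c C →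
      MDifferentiableAt (I.prod I) 𝓘(ℝ, ℝ) (fun q : Γ × Γ => b q.1 + c q.2) (y, G.mul x y) :=
    fun {b c} hb hc => MDifferentiableAt.add (f := b ∘ Prod.fst) (g := c ∘ Prod.snd)
      ((hd hb hB hy).comp (y, G.mul x y) mdifferentiableAt_fst)
      ((hd hc hC hz).comp (y, G.mul x y) mdifferentiableAt_snd)
  rw [poissonBracket_prod_add (p := (x, y, G.mul x y)) P _ (g := fun q => b q.1 + c q.2)
    (g' := fun q => b' q.1 + c' q.2) (hd ha hA hx) (hd ha' hA hx) (hbc hb hc) (hbc hb' hc'),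
    poissonBracket_prod_add (p := (y, G.mul x y)) P _ (hd hb hB hy) (hd hb' hB hy) (hd hc hC hz)
      (hd hc' hC hz), poissonBracket_neg] at key
  linarith

variable {U : Set Γ₀} {f g : Γ₀ → ℝ}

theorem contMDiffOn_comp_target (G : LieGroupoid I I₀ Γ Γ₀)
    (hf : ContMDiffOn I₀ 𝓘(ℝ, ℝ) ∞ f U) :
    ContMDiffOn I 𝓘(ℝ, ℝ) ∞ (f ∘ G.target) (G.target ⁻¹' U) :=
  hf.comp G.contMDiff_target.contMDiffOn fun _ hx => hx

theorem contMDiffOn_comp_source (G : LieGroupoid I I₀ Γ Γ₀)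
    (hf : ContMDiffOn I₀ 𝓘(ℝ, ℝ) ∞ f U) :
    ContMDiffOn I 𝓘(ℝ, ℝ) ∞ (f ∘ G.source) (G.source ⁻¹' U) :=
  hf.comp G.contMDiff_source.contMDiffOn fun _ hx => hx

/-- The bracket of two functions pulled back by the target map is constant along the target
fibres. -/
theorem IsPoissonGroupoid.bracket_target (hP : G.IsPoissonGroupoid P) (hU : IsOpen U)
    (hf : ContMDiffOn I₀ 𝓘(ℝ, ℝ) ∞ f U) (hg : ContMDiffOn I₀ 𝓘(ℝ, ℝ) ∞ g U)
    {x : Γ} (hx : G.target x ∈ U) :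
    poissonBracket P (f ∘ G.target) (g ∘ G.target) x
      = poissonBracket P (f ∘ G.target) (g ∘ G.target) (G.unit (G.target x)) := by
  have hV : IsOpen (G.target ⁻¹' U) := hU.preimage G.contMDiff_target.continuous
  have hz : G.mul x (G.inv x) ∈ G.target ⁻¹' U := by
    rwa [mem_preimage, G.target_mul _ _ (G.target_inv x).symm]
  -- `f(α x) - f(α(xy))` vanishes on the graph; it is evaluated at `y = x⁻¹`, where the product is
  -- the unit `α x`.
  have key := hP.bracket_add_sub_eq_zero (a := f ∘ G.target) (a' := g ∘ G.target)
    (b := fun _ => 0) (b' := fun _ => 0)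
    (c := fun z => -(f ∘ G.target) z) (c' := fun z => -(g ∘ G.target) z) hV isOpen_univ hV
    (G.contMDiffOn_comp_target hf) (G.contMDiffOn_comp_target hg) contMDiffOn_const
    contMDiffOn_const (G.contMDiffOn_comp_target hf).neg (G.contMDiffOn_comp_target hg).neg
    (fun x y h => by simp [G.target_mul x y h]) (fun x y h => by simp [G.target_mul x y h])
    (G.target_inv x).symm hx (mem_univ _) hz
  rw [poissonBracket_const_left, poissonBracket_neg_neg, G.mul_inv, add_zero] at key
  exact sub_eq_zero.1 key

/-- The bracket of two functions pulled back by the source map is constant along the source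
fibres. -/
theorem IsPoissonGroupoid.bracket_source (hP : G.IsPoissonGroupoid P) (hU : IsOpen U)
    (hf : ContMDiffOn I₀ 𝓘(ℝ, ℝ) ∞ f U) (hg : ContMDiffOn I₀ 𝓘(ℝ, ℝ) ∞ g U)
    {x : Γ} (hx : G.source x ∈ U) :
    poissonBracket P (f ∘ G.source) (g ∘ G.source) x
      = poissonBracket P (f ∘ G.source) (g ∘ G.source) (G.unit (G.source x)) := by
  have hV : IsOpen (G.source ⁻¹' U) := hU.preimage G.contMDiff_source.continuous
  have hz : G.mul (G.inv x) x ∈ G.source ⁻¹' U := by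
    rwa [mem_preimage, G.source_mul _ _ (G.source_inv x)]
  -- The mirror image: `f(β y) - f(β(xy))`, evaluated at the composable pair `(x⁻¹, x)`.
  have key := hP.bracket_add_sub_eq_zero (a := fun _ => 0) (a' := fun _ => 0)
    (b := f ∘ G.source) (b' := g ∘ G.source)
    (c := fun z => -(f ∘ G.source) z) (c' := fun z => -(g ∘ G.source) z) isOpen_univ hV hV
    contMDiffOn_const contMDiffOn_const
    (G.contMDiffOn_comp_source hf) (G.contMDiffOn_comp_source hg)
    (G.contMDiffOn_comp_source hf).neg (G.contMDiffOn_comp_source hg).neg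
    (fun x y h => by simp [G.source_mul x y h]) (fun x y h => by simp [G.source_mul x y h])
    (G.source_inv x) (mem_univ _) hx hz
  rw [poissonBracket_const_left, poissonBracket_neg_neg, G.inv_mul, zero_add] at key
  exact sub_eq_zero.1 key

/-- The function `f(β x) - f(α y)` vanishes on the graph by the very condition of composability. At
the pair of units `(ε u, ε u)` this relates the brackets pulled back by the two maps, with opposite
signs. -/
theorem IsPoissonGroupoid.bracket_source_unit (hP : G.IsPoissonGroupoid P) (hU : IsOpen U)
    (hf : ContMDiffOn I₀ 𝓘(ℝ, ℝ) ∞ f U) (hg : ContMDiffOn I₀ 𝓘(ℝ, ℝ) ∞ g U)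
    {u : Γ₀} (hu : u ∈ U) :
    poissonBracket P (f ∘ G.source) (g ∘ G.source) (G.unit u)
      = -poissonBracket P (f ∘ G.target) (g ∘ G.target) (G.unit u) := by
  have hV : IsOpen (G.target ⁻¹' U) := hU.preimage G.contMDiff_target.continuous
  have hV' : IsOpen (G.source ⁻¹' U) := hU.preimage G.contMDiff_source.continuous
  have key := hP.bracket_add_sub_eq_zero (a := f ∘ G.source) (a' := g ∘ G.source)
    (b := fun z => -(f ∘ G.target) z) (b' := fun z => -(g ∘ G.target) z)
    (c := fun _ => 0) (c' := fun _ => 0) hV' hV isOpen_univ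
    (G.contMDiffOn_comp_source hf) (G.contMDiffOn_comp_source hg)
    (G.contMDiffOn_comp_target hf).neg (G.contMDiffOn_comp_target hg).neg
    contMDiffOn_const contMDiffOn_const
    (fun x y h => by simp [h]) (fun x y h => by simp [h])
    (x := G.unit u) (y := G.unit u) (by rw [G.source_unit, G.target_unit])
    (by rwa [mem_preimage, G.source_unit]) (by rwa [mem_preimage, G.target_unit]) (mem_univ _)
  rw [poissonBracket_const_left, poissonBracket_neg_neg, sub_zero] at key
  exact eq_neg_of_add_eq_zero_left key

/-- The bivector field on the units of a Lie groupoid obtained from a contravariant 2-tensor field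
on the groupoid by projection along the target map. -/
def unitBivector (G : LieGroupoid I I₀ Γ Γ₀) (P : CotensorField₂ I Γ) : CotensorField₂ I₀ Γ₀ :=
  fun u =>
    -- The differential lands in the tangent space at `G.target (G.unit u)`, a point equal to `u`
    -- only propositionally. Both tangent spaces unfold to `E₀`, which allows the retyping.
    let T : TangentSpace I (G.unit u) →L[ℝ] TangentSpace I₀ u :=
      (mfderiv I I₀ G.target (G.unit u) : E →L[ℝ] E₀)
    let pull : CotangentSpace I₀ u →ₗ[ℝ] CotangentSpace I (G.unit u) :=
      { toFun := fun a => a.comp T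
        map_add' := fun _ _ => rfl
        map_smul' := fun _ _ => rfl }
    (P (G.unit u)).compl₁₂ pull pull

theorem bracket_unitBivector {u : Γ₀} (hf : MDifferentiableAt I₀ 𝓘(ℝ, ℝ) f u)
    (hg : MDifferentiableAt I₀ 𝓘(ℝ, ℝ) g u) :
    poissonBracket (G.unitBivector P) f g u
      = poissonBracket P (f ∘ G.target) (g ∘ G.target) (G.unit u) := by
  have hT : MDifferentiableAt I I₀ G.target (G.unit u) :=
    G.contMDiff_target.mdifferentiable (by simp) _
  have hpull : ∀ {f : Γ₀ → ℝ}, MDifferentiableAt I₀ 𝓘(ℝ, ℝ) f u →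
      mvfderiv I (f ∘ G.target) (G.unit u) = (mvfderiv I₀ f u : E₀ →L[ℝ] ℝ).comp
        (mfderiv I I₀ G.target (G.unit u) : E →L[ℝ] E₀) := by
    intro f hf
    have hf' : MDifferentiableAt I₀ 𝓘(ℝ, ℝ) f (G.target (G.unit u)) := by
      rwa [G.target_unit]
    rw [mvfderiv_comp _ hf' hT]
    -- The base point is generalized to a variable so that `target_unit` can be substituted without
    -- a dependent rewrite.
    have : ∀ (v : Γ₀) (T : E →L[ℝ] E₀), v = u → (mvfderiv I₀ f v : E₀ →L[ℝ] ℝ).comp T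
        = (mvfderiv I₀ f u : E₀ →L[ℝ] ℝ).comp T := by
      rintro v T rfl; rfl
    exact this _ _ (G.target_unit u)
  rw [poissonBracket, poissonBracket, hpull hf, hpull hg]
  rfl

theorem IsPoissonGroupoid.bracket_unitBivector_comp_target (hP : G.IsPoissonGroupoid P)
    (hU : IsOpen U) (hf : ContMDiffOn I₀ 𝓘(ℝ, ℝ) ∞ f U) (hg : ContMDiffOn I₀ 𝓘(ℝ, ℝ) ∞ g U)
    {x : Γ} (hx : G.target x ∈ U) :
    poissonBracket (G.unitBivector P) f g (G.target x)
      = poissonBracket P (f ∘ G.target) (g ∘ G.target) x := by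
  rw [hP.bracket_target hU hf hg hx, bracket_unitBivector]
  · exact (hf.contMDiffAt (hU.mem_nhds hx)).mdifferentiableAt (by simp)
  · exact (hg.contMDiffAt (hU.mem_nhds hx)).mdifferentiableAt (by simp)

theorem IsPoissonGroupoid.isBivectorField_unitBivector (hP : G.IsPoissonGroupoid P) :
    IsBivectorField (G.unitBivector P) where
  alt u a := hP.poisson.alt (G.unit u) _
  smooth U hU f g hf hg := by
    have hV : IsOpen (G.target ⁻¹' U) := hU.preimage G.contMDiff_target.continuous
    -- On `U` the bracket is a smooth bracket on `Γ` composed with the unit section.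
    refine ((hP.poisson.smooth _ hV _ _ (G.contMDiffOn_comp_target hf)
      (G.contMDiffOn_comp_target hg)).comp G.contMDiff_unit.contMDiffOn (s := U) ?_).congr ?_
    · intro u hu
      rwa [mem_preimage, mem_preimage, G.target_unit]
    · intro u hu
      exact bracket_unitBivector
        ((hf.contMDiffAt (hU.mem_nhds hu)).mdifferentiableAt (by simp))
        ((hg.contMDiffAt (hU.mem_nhds hu)).mdifferentiableAt (by simp))

/-- The outer bracket differentiates the inner one, so the inner brackets must agree on a
neighbourhood of the unit in `Γ`, not only along the units. Constancy along the target fibres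
provides this. -/
theorem IsPoissonGroupoid.bracket_bracket_unitBivector (hP : G.IsPoissonGroupoid P)
    (hU : IsOpen U) {h : Γ₀ → ℝ} (hf : ContMDiffOn I₀ 𝓘(ℝ, ℝ) ∞ f U)
    (hg : ContMDiffOn I₀ 𝓘(ℝ, ℝ) ∞ g U) (hh : ContMDiffOn I₀ 𝓘(ℝ, ℝ) ∞ h U)
    {u : Γ₀} (hu : u ∈ U) :
    poissonBracket (G.unitBivector P) (poissonBracket (G.unitBivector P) f g) h u
      = poissonBracket P (poissonBracket P (f ∘ G.target) (g ∘ G.target)) (h ∘ G.target)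
        (G.unit u) := by
  have hV : IsOpen (G.target ⁻¹' U) := hU.preimage G.contMDiff_target.continuous
  rw [bracket_unitBivector
    (((hP.isBivectorField_unitBivector.smooth U hU f g hf hg).contMDiffAt
      (hU.mem_nhds hu)).mdifferentiableAt (by simp))
    ((hh.contMDiffAt (hU.mem_nhds hu)).mdifferentiableAt (by simp))]
  refine poissonBracket_congr P ?_ EventuallyEq.rfl
  filter_upwards [hV.mem_nhds (show G.unit u ∈ G.target ⁻¹' U by
    rwa [mem_preimage, G.target_unit])] with x hx
  exact hP.bracket_unitBivector_comp_target hU hf hg hx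

theorem IsPoissonGroupoid.isPoissonStructure_unitBivector (hP : G.IsPoissonGroupoid P) :
    IsPoissonStructure (G.unitBivector P) where
  toIsBivectorField := hP.isBivectorField_unitBivector
  schouten U hU f g h hf hg hh u hu := by
    have hV : IsOpen (G.target ⁻¹' U) := hU.preimage G.contMDiff_target.continuous
    have := hP.poisson.schouten _ hV _ _ _ (G.contMDiffOn_comp_target hf)
      (G.contMDiffOn_comp_target hg) (G.contMDiffOn_comp_target hh) (G.unit u)
      (by rwa [mem_preimage, G.target_unit])
    rw [schoutenBracket] at this ⊢
    rwa [hP.bracket_bracket_unitBivector hU hf hg hh hu,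
      hP.bracket_bracket_unitBivector hU hg hh hf hu,
      hP.bracket_bracket_unitBivector hU hh hf hg hu]

theorem IsPoissonGroupoid.isPoissonMap_target (hP : G.IsPoissonGroupoid P) :
    IsPoissonMap G.target P (G.unitBivector P) where
  smooth := G.contMDiff_target
  map_bracket _ _ hf hg _ := (hP.bracket_unitBivector_comp_target isOpen_univ hf.contMDiffOn
    hg.contMDiffOn (mem_univ _)).symm

theorem IsPoissonGroupoid.isPoissonMap_source (hP : G.IsPoissonGroupoid P) :
    IsPoissonMap G.source P (-G.unitBivector P) where
  smooth := G.contMDiff_source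
  map_bracket f g hf hg x := by
    rw [poissonBracket_neg, bracket_unitBivector (hf.mdifferentiable (by simp) _)
      (hg.mdifferentiable (by simp) _), hP.bracket_source isOpen_univ hf.contMDiffOn
      hg.contMDiffOn (mem_univ _), hP.bracket_source_unit isOpen_univ hf.contMDiffOn
      hg.contMDiffOn (mem_univ _)]

/-- As `G.target` is surjective and `Γ₀` has enough smooth functions, at most one bivector field on
`Γ₀` makes `G.target` a Poisson map. -/
theorem eq_of_isPoissonMap_target [FiniteDimensional ℝ E₀] [I₀.Boundaryless]
    {P₀ P₁ : CotensorField₂ I₀ Γ₀} (h₀ : IsPoissonMap G.target P P₀)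
    (h₁ : IsPoissonMap G.target P P₁) : P₁ = P₀ := by
  funext u
  refine LinearMap.ext₂ fun a b => ?_
  obtain ⟨f, hf, rfl⟩ := exists_contMDiff_mvfderiv_eq u a
  obtain ⟨g, hg, rfl⟩ := exists_contMDiff_mvfderiv_eq u b
  change poissonBracket P₁ f g u = poissonBracket P₀ f g u
  have e₀ := h₀.map_bracket f g hf hg (G.unit u)
  have e₁ := h₁.map_bracket f g hf hg (G.unit u)
  rw [G.target_unit] at e₀ e₁
  rw [← e₀, ← e₁]

end LieGroupoid

end PoissonGroupoid

/-! ### The Jacobi identity for a closed nondegenerate 2-form on a vector space. -/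

section LocalForm

variable {E : Type*} [NormedAddCommGroup E] [NormedSpace ℝ E]

/-- The continuous linear map sending a 2-form `η` on `E` to `v ↦ -i(v)η`. -/
def negContraction : (E [⋀^Fin 2]→L[ℝ] ℝ) →L[ℝ] E →L[ℝ] E →L[ℝ] ℝ :=
  -(ContinuousLinearMap.compL ℝ E (E [⋀^Fin 1]→L[ℝ] ℝ) (E →L[ℝ] ℝ)
      (ContinuousAlternatingMap.ofSubsingletonLIE (𝕜 := ℝ) (E := E) (F := ℝ)
        (0 : Fin 1)).symm.toContinuousLinearEquiv.toContinuousLinearMap ∘L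
    (ContinuousAlternatingMap.curryLeftLI (𝕜 := ℝ) (E := E) (F := ℝ) (n := 1)).toContinuousLinearMap)

theorem negContraction_apply (η : E [⋀^Fin 2]→L[ℝ] ℝ) (v w : E) :
    negContraction η v w = -η ![v, w] := by
  change -η (Matrix.vecCons v fun _ => w) = -η ![v, w]
  congr 2
  ext i
  fin_cases i <;> rfl

theorem negContraction_swap (η : E [⋀^Fin 2]→L[ℝ] ℝ) (v w : E) :
    negContraction η v w = -negContraction η w v := by
  rw [negContraction_apply, negContraction_apply]
  have h : η (![w, v] ∘ Equiv.swap 0 1) = -η ![w, v] := η.map_swap ![w, v] (by simp)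
  rw [← h]
  congr 2
  ext i
  fin_cases i <;> rfl

theorem contDiffAt_negContraction_comp {F : Type*} [NormedAddCommGroup F] [NormedSpace ℝ F]
    {η : F → E [⋀^Fin 2]→L[ℝ] ℝ} {y : F} {n : WithTop ℕ∞} (h : ContDiffAt ℝ n η y) :
    ContDiffAt ℝ n (fun z => negContraction (η z)) y := by
  fun_prop

set_option maxSynthPendingDepth 10 in
theorem fderiv_negContraction_comp {F : Type*} [NormedAddCommGroup F] [NormedSpace ℝ F]
    {η : F → E [⋀^Fin 2]→L[ℝ] ℝ} {y : F} (h : DifferentiableAt ℝ η y) (a : F) :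
    fderiv ℝ (fun z => negContraction (η z)) y a = negContraction (fderiv ℝ η y a) :=
  congrArg (fun l => l a) (negContraction.hasFDerivAt.comp y h.hasFDerivAt).fderiv

/-- The exterior derivative is the alternating sum of `D_a η(b, c)`, `D_b η(a, c)`, `D_c η(a, b)`;
skew-symmetry of the middle term makes it cyclic. -/
theorem extDeriv_cyclic {η : E → E [⋀^Fin 2]→L[ℝ] ℝ} {y : E} (h : extDeriv η y = 0) (a b c : E) :
    negContraction (fderiv ℝ η y a) b c + negContraction (fderiv ℝ η y b) c a
      + negContraction (fderiv ℝ η y c) a b = 0 := by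
  have h0 := congrArg (fun θ => θ ![a, b, c]) h
  simp only [extDeriv, ContinuousAlternatingMap.alternatizeUncurryFin_apply] at h0
  rw [Fin.sum_univ_three] at h0
  have e0 : (0 : Fin 3).removeNth ![a, b, c] = ![b, c] := by ext i; fin_cases i <;> rfl
  have e1 : (1 : Fin 3).removeNth ![a, b, c] = ![a, c] := by ext i; fin_cases i <;> rfl
  have e2 : (2 : Fin 3).removeNth ![a, b, c] = ![a, b] := by ext i; fin_cases i <;> rfl
  rw [e0, e1, e2] at h0
  rw [negContraction_swap _ c a]
  simp only [negContraction_apply]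
  simp at h0
  linarith

/-- The vector field `X_f` with `Φ(X_f) = df`. -/
def localHamiltonian (Φ : E → E →L[ℝ] E →L[ℝ] ℝ) (f : E → ℝ) (y : E) : E :=
  (Φ y).inverse (fderiv ℝ f y)

/-- The bracket `{f, g} = dg(X_f)`. -/
def localBracket (Φ : E → E →L[ℝ] E →L[ℝ] ℝ) (f g : E → ℝ) (y : E) : ℝ :=
  fderiv ℝ g y (localHamiltonian Φ f y)

variable {Φ : E → E →L[ℝ] E →L[ℝ] ℝ} {f g h : E → ℝ} {y : E}

theorem localBracket_congr {f' g' : E → ℝ} (hf : f =ᶠ[𝓝 y] f') (hg : g =ᶠ[𝓝 y] g') :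
    localBracket Φ f g y = localBracket Φ f' g' y := by
  rw [localBracket, localBracket, localHamiltonian, localHamiltonian, hf.fderiv_eq, hg.fderiv_eq]

theorem ContDiffAt.fderiv_infty {F : Type*} [NormedAddCommGroup F] [NormedSpace ℝ F] {u : E → F}
    (hu : ContDiffAt ℝ ∞ u y) : ContDiffAt ℝ ∞ (fderiv ℝ u) y :=
  hu.fderiv_right (m := ∞) (by simp)

theorem contDiffAt_localHamiltonian [CompleteSpace E] (hΦ : ContDiffAt ℝ ∞ Φ y)
    (hinv : (Φ y).IsInvertible) (hf : ContDiffAt ℝ ∞ f y) :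
    ContDiffAt ℝ ∞ (localHamiltonian Φ f) y :=
  (ContDiffAt.comp y hinv.contDiffAt_map_inverse hΦ).clm_apply hf.fderiv_infty

theorem contDiffAt_localBracket [CompleteSpace E] (hΦ : ContDiffAt ℝ ∞ Φ y)
    (hinv : (Φ y).IsInvertible) (hf : ContDiffAt ℝ ∞ f y) (hg : ContDiffAt ℝ ∞ g y) :
    ContDiffAt ℝ ∞ (localBracket Φ f g) y :=
  hg.fderiv_infty.clm_apply (contDiffAt_localHamiltonian hΦ hinv hf)

theorem apply_localHamiltonian (hinv : (Φ y).IsInvertible) (f : E → ℝ) :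
    Φ y (localHamiltonian Φ f y) = fderiv ℝ f y :=
  hinv.self_apply_inverse _

/-- The derivative of `X_f` is never computed. Differentiating `Φ X_f = df` and pairing with `X_g`
yields `Φ(D_v X_f, X_g)`, which by skew-symmetry is `-dg(D_v X_f)`, the term arising from `{f, g} =
dg(X_f)`. -/
theorem fderiv_localBracket [CompleteSpace E] (hΦ : ContDiffAt ℝ ∞ Φ y)
    (hinv : ∀ᶠ z in 𝓝 y, (Φ z).IsInvertible) (hskew : ∀ v w, Φ y v w = -Φ y w v)
    (hf : ContDiffAt ℝ ∞ f y) (hg : ContDiffAt ℝ ∞ g y) (v : E) :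
    fderiv ℝ (localBracket Φ f g) y v
      = fderiv ℝ (fderiv ℝ g) y v (localHamiltonian Φ f y)
        - fderiv ℝ (fderiv ℝ f) y v (localHamiltonian Φ g y)
        + fderiv ℝ Φ y v (localHamiltonian Φ f y) (localHamiltonian Φ g y) := by
  have hX := (contDiffAt_localHamiltonian hΦ hinv.self_of_nhds hf).differentiableAt (by simp)
  have hg' := hg.fderiv_infty.differentiableAt (by simp)
  have e1 : fderiv ℝ (localBracket Φ f g) y v
      = fderiv ℝ g y (fderiv ℝ (localHamiltonian Φ f) y v)
        + fderiv ℝ (fderiv ℝ g) y v (localHamiltonian Φ f y) := by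
    change fderiv ℝ (fun z => fderiv ℝ g z (localHamiltonian Φ f z)) y v = _
    rw [fderiv_clm_apply hg' hX]
    rfl
  have e2 : Φ y (fderiv ℝ (localHamiltonian Φ f) y v)
        + fderiv ℝ Φ y v (localHamiltonian Φ f y) = fderiv ℝ (fderiv ℝ f) y v := by
    have hev : (fun z => Φ z (localHamiltonian Φ f z)) =ᶠ[𝓝 y] fderiv ℝ f := by
      filter_upwards [hinv] with z hz using apply_localHamiltonian hz f
    rw [← hev.fderiv_eq, fderiv_clm_apply (hΦ.differentiableAt (by simp)) hX]
    rfl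
  have e3 := congrArg (fun l => l (localHamiltonian Φ g y)) e2
  simp only [add_apply] at e3
  rw [hskew, apply_localHamiltonian hinv.self_of_nhds] at e3
  rw [e1]
  linarith

/-- Expand `{{f, g}, h} = -d{f, g}(X_h)` by `fderiv_localBracket`. In the cyclic sum the Hessian
terms cancel by symmetry of second derivatives, and the terms in `DΦ` form the cyclic sum that
closedness annihilates. -/
theorem localBracket_jacobi [CompleteSpace E] (hΦ : ContDiffAt ℝ ∞ Φ y)
    (hinv : ∀ᶠ z in 𝓝 y, (Φ z).IsInvertible) (hskew : ∀ v w, Φ y v w = -Φ y w v)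
    (hclosed : ∀ a b c, fderiv ℝ Φ y a b c + fderiv ℝ Φ y b c a + fderiv ℝ Φ y c a b = 0)
    (hf : ContDiffAt ℝ ∞ f y) (hg : ContDiffAt ℝ ∞ g y) (hh : ContDiffAt ℝ ∞ h y) :
    localBracket Φ (localBracket Φ f g) h y + localBracket Φ (localBracket Φ g h) f y
      + localBracket Φ (localBracket Φ h f) g y = 0 := by
  have hswap : ∀ u w : E → ℝ, localBracket Φ u w y = -fderiv ℝ u y (localHamiltonian Φ w y) := by
    intro u w
    rw [localBracket, ← apply_localHamiltonian hinv.self_of_nhds w, hskew,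
      apply_localHamiltonian hinv.self_of_nhds]
  have hsymm : ∀ {u : E → ℝ}, ContDiffAt ℝ ∞ u y → ∀ a b,
      fderiv ℝ (fderiv ℝ u) y a b = fderiv ℝ (fderiv ℝ u) y b a := fun hu a b =>
    hu.isSymmSndFDerivAt (by rw [minSmoothness_of_isRCLikeNormedField]; exact WithTop.coe_le_coe.2 le_top) a b
  rw [hswap _ h, hswap _ f, hswap _ g, fderiv_localBracket hΦ hinv hskew hf hg,
    fderiv_localBracket hΦ hinv hskew hg hh, fderiv_localBracket hΦ hinv hskew hh hf]
  have hc := hclosed (localHamiltonian Φ f y) (localHamiltonian Φ g y) (localHamiltonian Φ h y)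
  have sf := hsymm hf (localHamiltonian Φ g y) (localHamiltonian Φ h y)
  have sg := hsymm hg (localHamiltonian Φ f y) (localHamiltonian Φ h y)
  have sh := hsymm hh (localHamiltonian Φ f y) (localHamiltonian Φ g y)
  linarith

end LocalForm

/-! ### The Poisson structure of a symplectic manifold. -/

section SymplecticPoisson

variable {E : Type*} [NormedAddCommGroup E] [NormedSpace ℝ E]
  {H : Type*} [TopologicalSpace H] {I : ModelWithCorners ℝ E H}
  {M : Type*} [TopologicalSpace M] [ChartedSpace H M] 
  {σ : TwoForm I M}

theorem TwoForm.flat_apply (σ : TwoForm I M) (x : M) (v w : TangentSpace I x) :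
    σ.flat x v w = -σ x ![v, w] := rfl

theorem TwoForm.apply_self (σ : TwoForm I M) (x : M) (v : TangentSpace I x) :
    σ x ![v, v] = 0 :=
  (σ x).map_eq_zero_of_eq ![v, v] (i := 0) (j := 1) rfl (by simp)

theorem TwoForm.map_neg_left (σ : TwoForm I M) (x : M) (v w : TangentSpace I x) :
    σ x ![-v, w] = -σ x ![v, w] := by
  rw [← neg_one_smul ℝ v, σ.map_smul_left, neg_one_mul]

theorem TwoForm.prod_apply {E' : Type*} [NormedAddCommGroup E'] [NormedSpace ℝ E']
    {H' : Type*} [TopologicalSpace H'] {J : ModelWithCorners ℝ E' H'}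
    {N : Type*} [TopologicalSpace N] [ChartedSpace H' N] (σ : TwoForm I M) (τ : TwoForm J N)
    (p : M × N) (v w : TangentSpace (I.prod J) p) :
    σ.prod τ p ![v, w] = σ p.1 ![tangentFst I J p v, tangentFst I J p w]
      + τ p.2 ![tangentSnd I J p v, tangentSnd I J p w] := by
  change σ p.1 (tangentFst I J p ∘ ![v, w]) + τ p.2 (tangentSnd I J p ∘ ![v, w]) = _
  congr 2 <;> (ext i; fin_cases i <;> rfl)

/-- The map `v ↦ -i(v)σ` read in the preferred chart at `x₀`. -/
def TwoForm.flatInChart (σ : TwoForm I M) (x₀ : M) (y : E) : E →L[ℝ] E →L[ℝ] ℝ :=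
  negContraction (σ.inChart x₀ y)

theorem TwoForm.flatInChart_apply (σ : TwoForm I M) (x₀ : M) (y v w : E) :
    σ.flatInChart x₀ y v w = σ.flat ((extChartAt I x₀).symm y)
      (mfderiv 𝓘(ℝ, E) I (extChartAt I x₀).symm y v)
      (mfderiv 𝓘(ℝ, E) I (extChartAt I x₀).symm y w) := by
  rw [TwoForm.flatInChart, negContraction_apply, TwoForm.flat_apply]
  congr 1
  change (σ _) (mfderiv 𝓘(ℝ, E) I (extChartAt I x₀).symm y ∘ ![v, w]) = _
  congr 1
  ext i
  fin_cases i <;> rfl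

variable [I.Boundaryless] {x₀ : M} {y : E}

theorem IsSymplecticForm.flat_sharp [FiniteDimensional ℝ E] (hσ : IsSymplecticForm σ) (x : M)
    (ζ : CotangentSpace I x) : σ.flat x (hσ.sharp x ζ) = ζ :=
  (LinearEquiv.ofBijective (σ.flat x) (hσ.flat_bijective x)).apply_symm_apply ζ

theorem IsSymplecticForm.apply_sharp [FiniteDimensional ℝ E] (hσ : IsSymplecticForm σ) (x : M)
    (ζ : CotangentSpace I x) (w : TangentSpace I x) : σ x ![hσ.sharp x ζ, w] = -ζ w := by
  rw [← congrArg (fun ξ : CotangentSpace I x => ξ w) (hσ.flat_sharp x ζ)]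
  exact (neg_neg _).symm

theorem IsSymplecticForm.poisson_apply [FiniteDimensional ℝ E] (hσ : IsSymplecticForm σ) (x : M)
    (ζ θ : CotangentSpace I x) : hσ.poisson x ζ θ = θ (hσ.sharp x ζ) := rfl

theorem IsSymplecticForm.contDiffAt_inChart (hσ : IsSymplecticForm σ)
    (hy : y ∈ (extChartAt I x₀).target) : ContDiffAt ℝ ∞ (σ.inChart x₀) y :=
  (hσ.smooth x₀).contDiffAt ((isOpen_extChartAt_target x₀).mem_nhds hy)

theorem IsSymplecticForm.contDiffAt_flatInChart (hσ : IsSymplecticForm σ)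
    (hy : y ∈ (extChartAt I x₀).target) : ContDiffAt ℝ ∞ (σ.flatInChart x₀) y :=
  contDiffAt_negContraction_comp (hσ.contDiffAt_inChart hy)

variable [IsManifold I ∞ M]

theorem isInvertible_mfderiv_extChartAt_symm (hy : y ∈ (extChartAt I x₀).target) :
    (mfderiv 𝓘(ℝ, E) I (extChartAt I x₀).symm y).IsInvertible := by
  have : IsManifold I 1 M := IsManifold.of_le (n := ∞) (by simp)
  have h := isInvertible_mfderivWithin_extChartAt_symm hy
  rwa [I.range_eq_univ, mfderivWithin_univ] at h

theorem mdifferentiableAt_extChartAt_symm (hy : y ∈ (extChartAt I x₀).target) :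
    MDifferentiableAt 𝓘(ℝ, E) I (extChartAt I x₀).symm y :=
  ((contMDiffOn_extChartAt_symm (n := ∞) x₀).contMDiffAt
    ((isOpen_extChartAt_target x₀).mem_nhds hy)).mdifferentiableAt (by simp)

theorem contDiffAt_comp_extChartAt_symm (hy : y ∈ (extChartAt I x₀).target) {f : M → ℝ}
    (hf : ContMDiffAt I 𝓘(ℝ, ℝ) ∞ f ((extChartAt I x₀).symm y)) :
    ContDiffAt ℝ ∞ (f ∘ (extChartAt I x₀).symm) y :=
  contMDiffAt_iff_contDiffAt.1 (hf.comp y ((contMDiffOn_extChartAt_symm x₀).contMDiffAt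
    ((isOpen_extChartAt_target x₀).mem_nhds hy)))

theorem fderiv_comp_extChartAt_symm (hy : y ∈ (extChartAt I x₀).target) {f : M → ℝ}
    (hf : MDifferentiableAt I 𝓘(ℝ, ℝ) f ((extChartAt I x₀).symm y)) (v : E) :
    fderiv ℝ (f ∘ (extChartAt I x₀).symm) y v
      = mvfderiv I f ((extChartAt I x₀).symm y)
        (mfderiv 𝓘(ℝ, E) I (extChartAt I x₀).symm y v) := by
  rw [← mfderiv_eq_fderiv]
  exact mfderiv_comp_apply y hf (mdifferentiableAt_extChartAt_symm hy) v

variable [FiniteDimensional ℝ E]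

/-- With `A` the differential of the inverse chart, the map is `Aᵀ ∘ flat ∘ A`, a composite of
bijections. -/
theorem IsSymplecticForm.isInvertible_flatInChart (hσ : IsSymplecticForm σ)
    (hy : y ∈ (extChartAt I x₀).target) : (σ.flatInChart x₀ y).IsInvertible := by
  have hA := isInvertible_mfderiv_extChartAt_symm hy
  have hflat := hσ.flat_bijective ((extChartAt I x₀).symm y)
  have hinj : Function.Injective (σ.flatInChart x₀ y) := by
    rw [injective_iff_map_eq_zero]
    intro v hv
    have h0 : σ.flat ((extChartAt I x₀).symm y)
        (mfderiv 𝓘(ℝ, E) I (extChartAt I x₀).symm y v) = 0 := by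
      ext w
      obtain ⟨w, rfl⟩ := hA.surjective w
      refine (σ.flatInChart_apply x₀ y v w).symm.trans ?_
      rw [hv]
      rfl
    rw [← map_zero (σ.flat _)] at h0
    exact hA.injective ((hflat.1 h0).trans (map_zero _).symm)
  have hsurj : Function.Surjective (σ.flatInChart x₀ y) := by
    intro θ
    obtain ⟨B, hB⟩ := hA
    obtain ⟨u, hu⟩ := hflat.2
      ((θ : TangentSpace 𝓘(ℝ, E) y →L[ℝ] ℝ).comp B.symm.toContinuousLinearMap)
    refine ⟨B.symm u, ?_⟩
    ext w
    refine (σ.flatInChart_apply x₀ y (B.symm u) w).trans ?_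
    rw [← hB]
    change σ.flat _ (B (B.symm u)) (B w) = θ w
    rw [B.apply_symm_apply, hu]
    exact congrArg θ (B.symm_apply_apply w)
  exact ⟨(LinearEquiv.ofBijective (σ.flatInChart x₀ y).toLinearMap
    ⟨hinj, hsurj⟩).toContinuousLinearEquiv, rfl⟩

theorem IsSymplecticForm.localBracket_eq (hσ : IsSymplecticForm σ)
    (hy : y ∈ (extChartAt I x₀).target) {f g : M → ℝ}
    (hf : MDifferentiableAt I 𝓘(ℝ, ℝ) f ((extChartAt I x₀).symm y))
    (hg : MDifferentiableAt I 𝓘(ℝ, ℝ) g ((extChartAt I x₀).symm y)) :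
    localBracket (σ.flatInChart x₀) (f ∘ (extChartAt I x₀).symm) (g ∘ (extChartAt I x₀).symm) y
      = poissonBracket hσ.poisson f g ((extChartAt I x₀).symm y) := by
  have hA := isInvertible_mfderiv_extChartAt_symm hy
  have hinv := hσ.isInvertible_flatInChart hy
  rw [localBracket, fderiv_comp_extChartAt_symm hy hg, poissonBracket, hσ.poisson_apply]
  congr 1
  -- It remains to see that the differential of the inverse chart carries the local Hamiltonian
  -- vector to `Π♯ df`. Both are compared after applying the injective map `flat`, which turns the
  -- claim into the chain rule for `f`.
  refine (hσ.flat_bijective _).1 ?_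
  rw [hσ.flat_sharp]
  ext w
  obtain ⟨w, rfl⟩ := hA.surjective w
  refine (σ.flatInChart_apply x₀ y _ w).symm.trans ?_
  rw [apply_localHamiltonian hinv]
  exact fderiv_comp_extChartAt_symm hy hf w

/-- Near `x`, the bracket of a symplectic manifold is the bracket computed in the chart at `x`. -/
theorem IsSymplecticForm.bracket_eventuallyEq (hσ : IsSymplecticForm σ) {f g : M → ℝ} {U : Set M}
    (hU : IsOpen U) (hf : ContMDiffOn I 𝓘(ℝ, ℝ) ∞ f U) (hg : ContMDiffOn I 𝓘(ℝ, ℝ) ∞ g U)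
    {x : M} (hx : x ∈ U) :
    poissonBracket hσ.poisson f g =ᶠ[𝓝 x]
      localBracket (σ.flatInChart x) (f ∘ (extChartAt I x).symm) (g ∘ (extChartAt I x).symm)
        ∘ extChartAt I x := by
  filter_upwards [hU.mem_nhds hx, extChartAt_source_mem_nhds (I := I) x] with z hz hz'
  have hzx := (extChartAt I x).left_inv hz'
  rw [Function.comp_apply, hσ.localBracket_eq ((extChartAt I x).map_source hz'), hzx]
  · rw [hzx]
    exact (hf.contMDiffAt (hU.mem_nhds hz)).mdifferentiableAt (by simp)
  · rw [hzx]
    exact (hg.contMDiffAt (hU.mem_nhds hz)).mdifferentiableAt (by simp)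

theorem IsSymplecticForm.isBivectorField_poisson (hσ : IsSymplecticForm σ) :
    IsBivectorField hσ.poisson where
  alt x a := by
    have h := hσ.apply_sharp x a (hσ.sharp x a)
    rw [σ.apply_self] at h
    rw [hσ.poisson_apply]
    linarith
  smooth U hU f g hf hg x hx := by
    have hy := mem_extChartAt_target (I := I) x
    have hsymm : (extChartAt I x).symm (extChartAt I x x) = x := extChartAt_to_inv x
    refine ContMDiffAt.contMDiffWithinAt (ContMDiffAt.congr_of_eventuallyEq ?_
      (hσ.bracket_eventuallyEq hU hf hg hx))
    refine ContMDiffAt.comp x (ContDiffAt.contMDiffAt (contDiffAt_localBracket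
      (hσ.contDiffAt_flatInChart hy) (hσ.isInvertible_flatInChart hy)
      (contDiffAt_comp_extChartAt_symm hy ?_) (contDiffAt_comp_extChartAt_symm hy ?_)))
      contMDiffAt_extChartAt
    · rw [hsymm]; exact hf.contMDiffAt (hU.mem_nhds hx)
    · rw [hsymm]; exact hg.contMDiffAt (hU.mem_nhds hx)

theorem IsSymplecticForm.bracket_bracket (hσ : IsSymplecticForm σ) {f g h : M → ℝ} {U : Set M}
    (hU : IsOpen U) (hf : ContMDiffOn I 𝓘(ℝ, ℝ) ∞ f U) (hg : ContMDiffOn I 𝓘(ℝ, ℝ) ∞ g U)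
    (hh : ContMDiffOn I 𝓘(ℝ, ℝ) ∞ h U) {x : M} (hx : x ∈ U) :
    poissonBracket hσ.poisson (poissonBracket hσ.poisson f g) h x
      = localBracket (σ.flatInChart x) (localBracket (σ.flatInChart x)
          (f ∘ (extChartAt I x).symm) (g ∘ (extChartAt I x).symm))
          (h ∘ (extChartAt I x).symm) (extChartAt I x x) := by
  have hy := mem_extChartAt_target (I := I) x
  have hfg := hσ.isBivectorField_poisson.smooth U hU f g hf hg
  rw [(hσ.bracket_eventuallyEq hU hfg hh hx).self_of_nhds, Function.comp_apply]
  refine localBracket_congr ?_ EventuallyEq.rfl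
  have hcont : Tendsto (extChartAt I x).symm (𝓝 (extChartAt I x x)) (𝓝 x) := by
    have := continuousAt_extChartAt_symm (I := I) x
    rwa [ContinuousAt, extChartAt_to_inv] at this
  filter_upwards [hcont.eventually (hσ.bracket_eventuallyEq hU hf hg hx),
    (isOpen_extChartAt_target x).mem_nhds hy] with z hz hz'
  rw [Function.comp_apply, hz, Function.comp_apply, (extChartAt I x).right_inv hz']

theorem IsSymplecticForm.isPoissonStructure_poisson (hσ : IsSymplecticForm σ) :
    IsPoissonStructure hσ.poisson where
  toIsBivectorField := hσ.isBivectorField_poisson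
  schouten U hU f g h hf hg hh x hx := by
    have hy := mem_extChartAt_target (I := I) x
    have hc : ∀ {u : M → ℝ}, ContMDiffOn I 𝓘(ℝ, ℝ) ∞ u U →
        ContDiffAt ℝ ∞ (u ∘ (extChartAt I x).symm) (extChartAt I x x) := fun hu =>
      contDiffAt_comp_extChartAt_symm hy (by
        rw [extChartAt_to_inv]; exact hu.contMDiffAt (hU.mem_nhds hx))
    have hfderiv : ∀ a, fderiv ℝ (σ.flatInChart x) (extChartAt I x x) a
        = negContraction (fderiv ℝ (σ.inChart x) (extChartAt I x x) a) := 
      fderiv_negContraction_comp ((hσ.contDiffAt_inChart hy).differentiableAt (by simp))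
    have key := localBracket_jacobi (hσ.contDiffAt_flatInChart hy)
      (eventually_of_mem ((isOpen_extChartAt_target x).mem_nhds hy)
        fun z hz => hσ.isInvertible_flatInChart hz)
      (fun v w => negContraction_swap _ v w)
      (fun a b c => by
        rw [hfderiv, hfderiv, hfderiv]
        exact extDeriv_cyclic (hσ.closed x _ hy) a b c)
      (hc hf) (hc hg) (hc hh)
    rw [schoutenBracket, hσ.bracket_bracket hU hf hg hh hx, hσ.bracket_bracket hU hg hh hf hx,
      hσ.bracket_bracket hU hh hf hg hx]
    -- For `P = Q` each term of `schoutenBracket` occurs twice, so it is twice the Jacobi sum.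
    linarith

end SymplecticPoisson

/-! ### Lagrangian submanifolds are coisotropic. -/

section Lagrangian

variable {E : Type*} [NormedAddCommGroup E] [NormedSpace ℝ E]
  {H : Type*} [TopologicalSpace H] {I : ModelWithCorners ℝ E H}
  {M : Type*} [TopologicalSpace M] [ChartedSpace H M]

/-- The differential of a function vanishing on `S` kills the vectors tangent to `S`. -/
theorem mvfderiv_eq_zero_of_mem_tangentVectors {S U : Set M} (hU : IsOpen U) {f : M → ℝ}
    (hf : ∀ x ∈ S ∩ U, f x = 0) {p : M} (hp : p ∈ U) (hfp : MDifferentiableAt I 𝓘(ℝ, ℝ) f p)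
    {v : TangentSpace I p} (hv : v ∈ tangentVectors (I := I) S p) : mvfderiv I f p v = 0 := by
  obtain ⟨γ, hγ, hS, hγv⟩ := hv
  -- The base points are identified before the fibre components, so that the latter live in the same
  -- tangent space.
  obtain rfl : γ 0 = p := congrArg (fun q : TangentBundle I M => q.proj) hγv
  obtain rfl : mfderiv 𝓘(ℝ, ℝ) I γ 0 (1 : ℝ) = v := by
    simpa [tangentMap] using hγv
  have hev : f ∘ γ =ᶠ[𝓝 0] fun _ => 0 := by
    filter_upwards [hS, hγ.continuousAt.eventually (hU.mem_nhds hp)] with t ht ht'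
    exact hf _ ⟨ht, ht'⟩
  have h := mvfderiv_comp_apply (0 : ℝ) hfp (hγ.mdifferentiableAt (by simp)) (1 : ℝ)
  rw [← h, mvfderiv_congr hev, mvfderiv_const]
  rfl

variable {Γ₀ : Type*} [TopologicalSpace Γ₀]
  {E₀ : Type*} [NormedAddCommGroup E₀] [NormedSpace ℝ E₀]
  {H₀ : Type*} [TopologicalSpace H₀] {I₀ : ModelWithCorners ℝ E₀ H₀}
  [ChartedSpace H₀ Γ₀] [IsManifold I₀ ∞ Γ₀] [T2Space Γ₀]
  [FiniteDimensional ℝ E] [I.Boundaryless] {σ : TwoForm I M}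

/-- The vector `(X, Y, -Z)` is the Hamiltonian vector of `f` for `σ ⊕ σ ⊕ (-σ)`, the sign on `Z`
coming from `-σ`. Since `df` kills the tangent vectors of `S`, it is orthogonal to them, hence
tangent to `S`; so `dg` kills it, and `dg(X, Y, -Z)` is the bracket. -/
theorem IsSymplecticForm.isCoisotropic_of_isLagrangian (hσ : IsSymplecticForm σ)
    {S : Set (M × M × M)} (hS : IsLagrangian (σ.prod (TwoForm.prod σ (-σ))) S) :
    IsCoisotropic (hσ.poisson.prod (CotensorField₂.prod hσ.poisson (-hσ.poisson))) S := by
  rintro U hU f g hf hg hf0 hg0 p ⟨hpS, hpU⟩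
  have hfp := (hf.contMDiffAt (hU.mem_nhds hpU)).mdifferentiableAt (by simp)
  have hgp := (hg.contMDiffAt (hU.mem_nhds hpU)).mdifferentiableAt (by simp)
  obtain ⟨x, y, z⟩ := p
  let a : E × E × E →L[ℝ] ℝ := mvfderiv (I.prod (I.prod I)) f (x, y, z)
  let b : E × E × E →L[ℝ] ℝ := mvfderiv (I.prod (I.prod I)) g (x, y, z)
  let X : E := hσ.sharp x (a.comp (ContinuousLinearMap.inl ℝ E (E × E)))
  let Y : E := hσ.sharp y
    ((a.comp (ContinuousLinearMap.inr ℝ E (E × E))).comp (ContinuousLinearMap.inl ℝ E E))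
  let Z : E := hσ.sharp z
    ((a.comp (ContinuousLinearMap.inr ℝ E (E × E))).comp (ContinuousLinearMap.inr ℝ E E))
  have hsum : ∀ (c : E × E × E →L[ℝ] ℝ) (u v w : E),
      c (u, 0, 0) + (c (0, v, 0) + c (0, 0, w)) = c (u, v, w) := by
    intro c u v w
    rw [← map_add, ← map_add]
    simp
  have hmem : ((X, Y, -Z) : E × E × E) ∈ tangentVectors (I := I.prod (I.prod I)) S (x, y, z) := by
    refine (hS (x, y, z) hpS (X, Y, -Z)).2 fun w hw => ?_
    obtain ⟨w₁, w₂, w₃⟩ : E × E × E := w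
    have h0 : a (w₁, w₂, w₃) = 0 :=
      mvfderiv_eq_zero_of_mem_tangentVectors hU hf0 hpU hfp hw
    have e₁ : σ x ![X, w₁] = -a (w₁, 0, 0) := hσ.apply_sharp x _ w₁
    have e₂ : σ y ![Y, w₂] = -a (0, w₂, 0) := hσ.apply_sharp y _ w₂
    have e₃ : σ z ![Z, w₃] = -a (0, 0, w₃) := hσ.apply_sharp z _ w₃
    have e₃' : σ z ![-Z, w₃] = -σ z ![Z, w₃] := σ.map_neg_left z Z w₃
    refine (TwoForm.prod_apply σ _ (x, y, z) (X, Y, -Z) (w₁, w₂, w₃)).trans ((congrArg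
      (σ x ![X, w₁] + ·) (TwoForm.prod_apply σ (-σ) (y, z) (Y, -Z) (w₂, w₃))).trans ?_)
    change σ x ![X, w₁] + (σ y ![Y, w₂] + -σ z ![-Z, w₃]) = 0
    have := hsum a w₁ w₂ w₃
    linarith
  have h0 : b (X, Y, -Z) = 0 := mvfderiv_eq_zero_of_mem_tangentVectors hU hg0 hpU hgp hmem
  have hZ : b (0, 0, -Z) = -b (0, 0, Z) := by
    rw [← map_neg]
    simp
  have := hsum b X Y (-Z)
  change b (X, 0, 0) + (b (0, Y, 0) + -b (0, 0, Z)) = 0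
  linarith

theorem LieGroupoid.IsSymplecticGroupoid.isPoissonGroupoid [IsManifold I ∞ M]
    {G : LieGroupoid I I₀ M Γ₀} (hσ : G.IsSymplecticGroupoid σ) :
    G.IsPoissonGroupoid hσ.symplectic.poisson where
  poisson := hσ.symplectic.isPoissonStructure_poisson
  coisotropic := hσ.symplectic.isCoisotropic_of_isLagrangian hσ.lagrangian

end Lagrangian

end

theorem corollary1
    {E : Type*} [NormedAddCommGroup E] [NormedSpace ℝ E] [FiniteDimensional ℝ E]
    {H : Type*} [TopologicalSpace H] {I : ModelWithCorners ℝ E H} [I.Boundaryless]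
    {E₀ : Type*} [NormedAddCommGroup E₀] [NormedSpace ℝ E₀] [FiniteDimensional ℝ E₀]
    {H₀ : Type*} [TopologicalSpace H₀] {I₀ : ModelWithCorners ℝ E₀ H₀} [I₀.Boundaryless]
    {Γ : Type*} [TopologicalSpace Γ] [ChartedSpace H Γ] [IsManifold I ∞ Γ]
    {Γ₀ : Type*} [TopologicalSpace Γ₀] [ChartedSpace H₀ Γ₀] [IsManifold I₀ ∞ Γ₀] [T2Space Γ₀]
    (G : LieGroupoid I I₀ Γ Γ₀) :
    -- a symplectic groupoid, with the Poisson structure of its symplectic form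
    (∀ (σ : TwoForm I Γ) (hσ : G.IsSymplecticGroupoid σ),
      ∃ P₀ : CotensorField₂ I₀ Γ₀, IsPoissonStructure P₀ ∧
        IsPoissonMap G.target hσ.symplectic.poisson P₀ ∧
        IsPoissonMap G.source hσ.symplectic.poisson (-P₀) ∧
        ∀ P₁ : CotensorField₂ I₀ Γ₀, IsPoissonStructure P₁ →
          IsPoissonMap G.target hσ.symplectic.poisson P₁ → P₁ = P₀) ∧
    -- a Poisson groupoid
    (∀ P : CotensorField₂ I Γ, G.IsPoissonGroupoid P →
      ∃ P₀ : CotensorField₂ I₀ Γ₀, IsPoissonStructure P₀ ∧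
        IsPoissonMap G.target P P₀ ∧
        IsPoissonMap G.source P (-P₀) ∧
        ∀ P₁ : CotensorField₂ I₀ Γ₀, IsPoissonStructure P₁ →
          IsPoissonMap G.target P P₁ → P₁ = P₀) := by
  have main : ∀ P : CotensorField₂ I Γ, G.IsPoissonGroupoid P →
      ∃ P₀ : CotensorField₂ I₀ Γ₀, IsPoissonStructure P₀ ∧
        IsPoissonMap G.target P P₀ ∧
        IsPoissonMap G.source P (-P₀) ∧
        ∀ P₁ : CotensorField₂ I₀ Γ₀, IsPoissonStructure P₁ →
          IsPoissonMap G.target P P₁ → P₁ = P₀ := fun P hP =>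
    ⟨G.unitBivector P, hP.isPoissonStructure_unitBivector, hP.isPoissonMap_target,
      hP.isPoissonMap_source, fun _ _ h =>
        LieGroupoid.eq_of_isPoissonMap_target hP.isPoissonMap_target h⟩
  exact ⟨fun σ hσ => main _ hσ.isPoissonGroupoid, main⟩
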